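/- Transfer functions are scalar, rational with real coefficients, and proper. Such an $H(s)$ is called passive if (i) all its poles satisfy $\Re s\le 0$; (ii) $H(j\omega)+\overline{H(j\omega)}\ge 0$ for every real $\omega$ such that $j\omega$ is not a pole of $H$; (iii) every pole $j\omega$ of $H$ on the imaginary axis is simple and $\lim_{s\to j\omega}(s-j\omega)H(s)$ is real and nonnegative. $H$ is strictly passive if $H(s-\varepsilon)$ is passive for some $\varepsilon>0$. For a real index $\sigma$, $G$ is strictly output-feedback (OF) passive with index $\sigma$ if $1-\sigma G$ is not identically zero and $H=(1-\sigma G)^{-1}G$ is proper and strictly passive. **Theorem (Robustness of passivization).** Let $\sigma>0$ and let $\mathcal D=\{z\in\mathbb C:\ |z-\tfrac1{2\sigma}|\le \tfrac1{2\sigma}\}$ be the positive damping (PD) disk. Let $G_0$ be a proper real rational transfer function without poles on the imaginary axis such that 1. as $\omega$ increases from $-\infty$ to $\infty$, the Nyquist plot $\omega\mapsto G_0(j\omega)$ makes as many counter-clockwise revolutions around the point $1/\sigma$ as $G_0$ has poles in $\Re s>0$, counted with multiplicity; 2. $G_0(j\omega)\in\mathcal D$ for all real $\omega$; 3. $G_0(j\omega)\ne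 1/\sigma$ for all real $\omega$. Suppose that $G_0$ is strictly OF passive with index $\sigma$ and that $$d_{\min}(\sigma)=\inf_{\omega\in\mathbb R}\Big\{\tfrac1{2\sigma}-\big|G_0(j\omega)-\tfrac1{2\sigma}\big|\Big\}>0 .$$ Let $\Delta$ be a proper real rational transfer function that is stable (all its poles satisfy $\Re s<0$), with $\mathcal H_\infty$ norm $\|\Delta\|_\infty=\sup_{\Re s>0}|\Delta(s)|<d_{\min}(\sigma)$. Then $G_0+\Delta$ is strictly OF passive with index $\sigma$. -/

import Mathlib

open Filter Topology

/-! Scalar finite-dimensional LTI systems are represented by their real rational transfer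
functions, i.e. elements of `RatFunc ℝ`. -/

namespace LTI

/-- The value `G(s)` of the rational function `G` at the complex point `s`
(meaningful when `s` is not a pole of `G`). -/
noncomputable def value (G : RatFunc ℝ) (s : ℂ) : ℂ :=
  RatFunc.eval (algebraMap ℝ ℂ) s G

/-- `s` is a pole of `G`: a root of the denominator of `G` in lowest terms. -/
def IsPole (G : RatFunc ℝ) (s : ℂ) : Prop :=
  Polynomial.aeval s G.denom = 0

/-- `G` is proper. These are exactly the transfer functions `C (sI - A)⁻¹ B + D`
of finite-dimensional state-space systems. -/
def IsProper (G : RatFunc ℝ) : Prop :=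
  G.num.natDegree ≤ G.denom.natDegree

/-- `G` is stable: all its poles lie in the open left half-plane. -/
def IsStable (G : RatFunc ℝ) : Prop :=
  ∀ s : ℂ, IsPole G s → s.re < 0

/-- The point `jω` of the imaginary axis. -/
noncomputable def jAxis (ω : ℝ) : ℂ := (ω : ℂ) * Complex.I

/-- The Nyquist plot `ω ↦ G(jω)`. -/
noncomputable def nyquist (G : RatFunc ℝ) (ω : ℝ) : ℂ := value G (jAxis ω)

/-- The translate `H(s - ε)`. -/
noncomputable def shift (ε : ℝ) (H : RatFunc ℝ) : RatFunc ℝ :=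
  algebraMap (Polynomial ℝ) (RatFunc ℝ)
      (H.num.comp (Polynomial.X - Polynomial.C ε)) /
    algebraMap (Polynomial ℝ) (RatFunc ℝ)
      (H.denom.comp (Polynomial.X - Polynomial.C ε))

/-- Passivity of the scalar LTI system with transfer function `H`. -/
structure IsPassive (H : RatFunc ℝ) : Prop where
  /-- `H` is the transfer function of a state-space system. -/
  proper : IsProper H
  /-- All poles lie in the closed left half-plane. -/
  poles : ∀ s : ℂ, IsPole H s → s.re ≤ 0
  /-- Positive damping: `H(jω) + H(jω)ᴴ ≥ 0` whenever `jω` is not a pole. -/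
  damping : ∀ ω : ℝ, ¬ IsPole H (jAxis ω) → 0 ≤ 2 * (nyquist H ω).re
  /-- Every purely imaginary pole is simple, with real nonnegative residue. -/
  residue : ∀ ω : ℝ, IsPole H (jAxis ω) →
    (H.denom.map (algebraMap ℝ ℂ)).rootMultiplicity (jAxis ω) = 1 ∧
    ∃ R : ℝ, 0 ≤ R ∧
      Tendsto (fun s : ℂ => (s - jAxis ω) * value H s) (𝓝[≠] (jAxis ω)) (𝓝 (R : ℂ))

/-- Strict passivity: `H(s - ε)` is passive for some `ε > 0`. -/
def IsStrictlyPassive (H : RatFunc ℝ) : Prop :=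
  ∃ ε : ℝ, 0 < ε ∧ IsPassive (shift ε H)

/-- The output-feedback system `H = (1 - G σ)⁻¹ G`. -/
noncomputable def ofSystem (σ : ℝ) (G : RatFunc ℝ) : RatFunc ℝ :=
  (1 - G * RatFunc.C σ)⁻¹ * G

/-- `G` is strictly output-feedback passive with index `σ`: the system
`H = (1 - G σ)⁻¹ G` is well defined and strictly passive. That `1 - G(s) σ ≠ 0` at every
point `s` at which `G` and `H` have no pole is then automatic, see `one_sub_ne_zero`. -/
def IsStrictlyOFPassive (σ : ℝ) (G : RatFunc ℝ) : Prop :=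
  1 - G * RatFunc.C σ ≠ 0 ∧ IsStrictlyPassive (ofSystem σ G)

theorem one_sub_ne_zero (σ : ℝ) (G : RatFunc ℝ) (h : 1 - G * RatFunc.C σ ≠ 0) (s : ℂ)
    (hG : ¬ IsPole G s) (hH : ¬ IsPole (ofSystem σ G) s) :
    1 - value G s * (σ : ℂ) ≠ 0 := by
  intro h0
  have e : ofSystem σ G = G + (G * RatFunc.C σ) * ofSystem σ G := by
    unfold ofSystem
    field_simp
    ring
  have hC : Polynomial.eval₂ (algebraMap ℝ ℂ) s (RatFunc.C σ).denom ≠ 0 := by simp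
  have hG' : Polynomial.eval₂ (algebraMap ℝ ℂ) s G.denom ≠ 0 := hG
  have hH' : Polynomial.eval₂ (algebraMap ℝ ℂ) s (ofSystem σ G).denom ≠ 0 := hH
  have hden : ∀ a b : RatFunc ℝ, Polynomial.eval₂ (algebraMap ℝ ℂ) s a.denom ≠ 0 →
      Polynomial.eval₂ (algebraMap ℝ ℂ) s b.denom ≠ 0 →
      Polynomial.eval₂ (algebraMap ℝ ℂ) s (a * b).denom ≠ 0 := by
    intro a b ha hb hab
    have := Polynomial.eval₂_eq_zero_of_dvd_of_eval₂_eq_zero (algebraMap ℝ ℂ) s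
      (RatFunc.denom_mul_dvd a b) hab
    rw [Polynomial.eval₂_mul] at this
    exact (mul_ne_zero ha hb) this
  have hGC := hden _ _ hG' hC
  have e2 := congrArg (value · s) e
  simp only [value] at e2 h0
  rw [RatFunc.eval_add (algebraMap ℝ ℂ) s hG' (hden _ _ hGC hH'), RatFunc.eval_mul (algebraMap ℝ ℂ) s hGC hH',
    RatFunc.eval_mul (algebraMap ℝ ℂ) s hG' hC, RatFunc.eval_C] at e2
  have h1 : RatFunc.eval (algebraMap ℝ ℂ) s G * (σ : ℂ) = 1 := by
    linear_combination -h0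
  rw [Complex.coe_algebraMap, h1, one_mul] at e2
  have h2 : RatFunc.eval (algebraMap ℝ ℂ) s G = 0 := by linear_combination -e2
  rw [h2, zero_mul] at h1
  exact zero_ne_one h1

/-- The positive damping region for an index `σ > 0`: the closed disk of radius `1/(2σ)`
centred at `1/(2σ)`. -/
noncomputable def pdRegion (σ : ℝ) : Set ℂ :=
  Metric.closedBall ((1 / (2 * σ) : ℝ) : ℂ) (1 / (2 * σ))

/-- As `ω` increases from `-∞` to `∞`, the plane curve `γ` makes exactly `n` counter-clockwise
revolutions around the point `p`: some continuous argument `θ` of `γ - p` has limits at `±∞`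
and increases by `2πn` in total. -/
def HasRevolutions (γ : ℝ → ℂ) (p : ℂ) (n : ℤ) : Prop :=
  ∃ θ : ℝ → ℝ, Continuous θ ∧
    (∀ ω : ℝ, γ ω - p = (‖γ ω - p‖ : ℂ) * Complex.exp ((θ ω : ℂ) * Complex.I)) ∧
    ∃ a b : ℝ, Tendsto θ atBot (𝓝 a) ∧ Tendsto θ atTop (𝓝 b) ∧ b - a = 2 * Real.pi * n

/-- The number of poles in the open right half-plane, counted with multiplicity. -/
noncomputable def numUnstablePoles (G : RatFunc ℝ) : ℕ :=
  ((G.denom.aroots ℂ).filter (fun s : ℂ => 0 < s.re)).card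

/-- The geometric (Nyquist-type) output-feedback conditions on `G` for an index `σ > 0`. -/
structure GeometricOFConditions (σ : ℝ) (G : RatFunc ℝ) : Prop where
  no_imaginary_pole : ∀ ω : ℝ, ¬ IsPole G (jAxis ω)
  revolutions : HasRevolutions (nyquist G) ((1 / σ : ℝ) : ℂ) (numUnstablePoles G)
  mem_region : ∀ ω : ℝ, nyquist G ω ∈ pdRegion σ
  avoids : ∀ ω : ℝ, nyquist G ω ≠ ((1 / σ : ℝ) : ℂ)

/-- The minimum signed distance `d_min(σ)` from the Nyquist plot to the boundary of the
positive damping disk (positive inside the disk). -/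
noncomputable def dMin (σ : ℝ) (G : RatFunc ℝ) : ℝ :=
  ⨅ ω : ℝ, (1 / (2 * σ) - ‖nyquist G ω - ((1 / (2 * σ) : ℝ) : ℂ)‖)

/-- The `H∞` norm of a stable transfer function, `sup_{Re s > 0} |Δ(s)|`. -/
noncomputable def hInfNorm (Δ : RatFunc ℝ) : ENNReal :=
  ⨆ (s : ℂ) (_ : 0 < s.re), ‖value Δ s‖ₑ

end LTI

namespace LTI

open Polynomial Bornology

/-! Put F = 1 - 2σG. Then H = G / (1 - σG) equals (1/σ)(1 - F)/(1 + F), a Cayley transform, so Re H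
≥ 0 wherever |F| ≤ 1 and F ≠ -1, and G(jω) lies in the PD disk exactly when |F(jω)| ≤ 1.

G₀ is stable: its H is proper, stable and of nonnegative real part on the axis, hence on the closed
right half-plane, whereas H = -1/σ at any pole of G₀ (`isStable_of_isStrictlyOFPassive`).
Phragmén–Lindelöf then carries the axis bound |1 - 2σG₀| ≤ 1 - 2σ d_min to the half-plane. Adding Δ
changes F by at most 2σ‖Δ‖ < 2σ d_min, so F stays a uniform strict contraction. Compactness extends
|F| < 1 past the axis (`exists_margin`), which gives strict passivity (`isStrictlyOFPassive_div`).
-/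

/-! ### Proper rational functions at infinity and on the right half-plane. -/

theorem tendsto_aeval_div_pow_cobounded {p : ℝ[X]} {n : ℕ} (hp : p.natDegree ≤ n) :
    Tendsto (fun s : ℂ => aeval s p / s ^ n) (cobounded ℂ) (𝓝 (p.coeff n : ℂ)) := by
  have hinv : Tendsto (fun s : ℂ => s⁻¹) (cobounded ℂ) (𝓝 0) := tendsto_inv₀_cobounded
  -- p(s)/sⁿ is the reflected polynomial at 1/s, so infinity becomes the point 0.
  have hcont : Tendsto (fun w : ℂ => aeval w (p.reflect n)) (𝓝 0) (𝓝 (p.coeff n : ℂ)) := by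
    refine (Polynomial.continuous_aeval _).tendsto' _ _ ?_
    rw [← Polynomial.coeff_zero_eq_aeval_zero', Polynomial.coeff_reflect]
    simp
  refine (hcont.comp hinv).congr' ?_
  filter_upwards [eventually_ne_cobounded (0 : ℂ)] with s hs
  let _ := invertibleOfNonzero hs
  have := Polynomial.eval₂_reflect_mul_pow (algebraMap ℝ ℂ) s n p hp
  rw [eq_div_iff (pow_ne_zero _ hs), Function.comp_apply, aeval_def, aeval_def, ← this, invOf_eq_inv]

theorem tendsto_aeval_div_aeval_cobounded {p q : ℝ[X]} (hq : q ≠ 0)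
    (h : p.natDegree ≤ q.natDegree) :
    Tendsto (fun s : ℂ => aeval s p / aeval s q) (cobounded ℂ)
      (𝓝 ((p.coeff q.natDegree : ℂ) / (q.leadingCoeff : ℂ))) := by
  have hlead : (q.leadingCoeff : ℂ) ≠ 0 := by simpa using hq
  refine ((tendsto_aeval_div_pow_cobounded h).div
    (tendsto_aeval_div_pow_cobounded le_rfl) hlead).congr' ?_
  filter_upwards [eventually_ne_cobounded (0 : ℂ)] with s hs
  exact div_div_div_cancel_right₀ (pow_ne_zero _ hs) _ _

theorem closure_re_pos : closure {z : ℂ | 0 < z.re} = {z : ℂ | 0 ≤ z.re} :=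
  Complex.closure_setOfPred_lt_re 0

theorem tendsto_ofReal_cobounded : Tendsto (fun x : ℝ => (x : ℂ)) atTop (cobounded ℂ) :=
  RCLike.tendsto_ofReal_atTop_cobounded ℂ

/-- Phragmén–Lindelöf in the right half-plane for functions with a finite limit at infinity. -/
theorem norm_le_of_tendsto_cobounded {f : ℂ → ℂ} {c : ℂ} {C : ℝ}
    (hd : DiffContOnCl ℂ f {z | 0 < z.re}) (hlim : Tendsto f (cobounded ℂ) (𝓝 c))
    (him : ∀ ω : ℝ, ‖f (jAxis ω)‖ ≤ C) {z : ℂ} (hz : 0 ≤ z.re) : ‖f z‖ ≤ C := by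
  -- A finite limit at infinity gives boundedness there, so growth exponent 1 < 2 with coefficient 0
  -- suffices.
  refine PhragmenLindelof.right_half_plane_of_bounded_on_real hd ⟨1, one_lt_two, 0, ?_⟩ ?_ him hz
  · have : f =O[cobounded ℂ] fun _ => (1 : ℝ) := hlim.isBigO_one ℝ
    simpa using this.mono inf_le_left
  · exact (hlim.norm.comp tendsto_ofReal_cobounded).isBoundedUnder_le

theorem diffContOnCl_aeval_div_aeval {p q : ℝ[X]}
    (hq : ∀ s : ℂ, 0 ≤ s.re → aeval s q ≠ 0) :
    DiffContOnCl ℂ (fun s : ℂ => aeval s p / aeval s q) {z | 0 < z.re} := by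
  refine DifferentiableOn.diffContOnCl ?_
  rw [closure_re_pos]
  exact p.differentiable_aeval.differentiableOn.div q.differentiable_aeval.differentiableOn
    fun s hs => hq s hs

theorem norm_aeval_le_of_jAxis {p q : ℝ[X]} (h : p.natDegree ≤ q.natDegree)
    (hq : ∀ s : ℂ, 0 ≤ s.re → aeval s q ≠ 0) {C : ℝ}
    (hC : ∀ ω : ℝ, ‖aeval (jAxis ω) p‖ ≤ C * ‖aeval (jAxis ω) q‖) {s : ℂ} (hs : 0 ≤ s.re) :
    ‖aeval s p‖ ≤ C * ‖aeval s q‖ := by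
  have hq0 : q ≠ 0 := by rintro rfl; exact hq 0 le_rfl (by simp)
  have := norm_le_of_tendsto_cobounded (C := C) (diffContOnCl_aeval_div_aeval (p := p) hq)
    (tendsto_aeval_div_aeval_cobounded hq0 h) (fun ω => ?_) hs
  · rwa [norm_div, div_le_iff₀ (norm_pos_iff.2 (hq s hs))] at this
  · rw [norm_div, div_le_iff₀ (norm_pos_iff.2 (hq _ (by simp [jAxis])))]
    exact hC ω

/-- The norm of exp(-p/q) is exp(-Re(p/q)), so this is the maximum principle for exp(-p/q) with
bound 1. -/
theorem re_aeval_div_nonneg_of_jAxis {p q : ℝ[X]} (h : p.natDegree ≤ q.natDegree)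
    (hq : ∀ s : ℂ, 0 ≤ s.re → aeval s q ≠ 0)
    (hre : ∀ ω : ℝ, 0 ≤ (aeval (jAxis ω) p / aeval (jAxis ω) q).re) {s : ℂ} (hs : 0 ≤ s.re) :
    0 ≤ (aeval s p / aeval s q).re := by
  have hq0 : q ≠ 0 := by rintro rfl; exact hq 0 le_rfl (by simp)
  have hd : DiffContOnCl ℂ (fun s : ℂ => Complex.exp (-(aeval s p / aeval s q)))
      {z | 0 < z.re} :=
    Complex.differentiable_exp.comp_diffContOnCl (diffContOnCl_aeval_div_aeval hq).neg
  have := norm_le_of_tendsto_cobounded (C := 1) hd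
    ((Complex.continuous_exp.tendsto _).comp
      (tendsto_aeval_div_aeval_cobounded hq0 h).neg) (fun ω => ?_) hs
  · simpa [Complex.norm_exp] using this
  · simpa [Complex.norm_exp] using hre ω

theorem norm_leadingCoeff_ratio_le {p q : ℝ[X]} (h : p.natDegree ≤ q.natDegree)
    (hq : ∀ s : ℂ, 0 ≤ s.re → aeval s q ≠ 0) {r : ℝ}
    (hr : ∀ s : ℂ, 0 ≤ s.re → ‖aeval s p‖ ≤ r * ‖aeval s q‖) :
    ‖(p.coeff q.natDegree : ℂ) / (q.leadingCoeff : ℂ)‖ ≤ r := by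
  have hq0 : q ≠ 0 := by rintro rfl; exact hq 0 le_rfl (by simp)
  refine le_of_tendsto ((tendsto_aeval_div_aeval_cobounded hq0 h).norm.comp
    tendsto_ofReal_cobounded) ?_
  filter_upwards [eventually_ge_atTop (0 : ℝ)] with x hx
  have hx' : (0 : ℝ) ≤ (x : ℂ).re := by simpa using hx
  rw [Function.comp_apply, norm_div, div_le_iff₀ (norm_pos_iff.2 (hq _ hx'))]
  exact hr _ hx'

/-- A proper rational function that is a strict contraction on the closed right half-plane is
still one on a slightly larger half-plane. -/
theorem exists_margin {p q : ℝ[X]} (h : p.natDegree ≤ q.natDegree)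
    (hq : ∀ s : ℂ, 0 ≤ s.re → aeval s q ≠ 0) {r : ℝ} (hr1 : r < 1)
    (hr : ∀ s : ℂ, 0 ≤ s.re → ‖aeval s p‖ ≤ r * ‖aeval s q‖) :
    ∃ ε : ℝ, 0 < ε ∧ ∀ s : ℂ, -ε ≤ s.re → ‖aeval s p‖ < ‖aeval s q‖ := by
  have hq0 : q ≠ 0 := by rintro rfl; exact hq 0 le_rfl (by simp)
  -- K is where the contraction fails. It is closed, bounded because |p/q| tends to a limit below 1,
  -- and contained in Re s < 0; so Re attains a negative maximum on K, and half of that maximum in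
  -- absolute value serves as ε.
  set K : Set ℂ := {s | ‖aeval s q‖ ≤ ‖aeval s p‖} with hK
  have hclosed : IsClosed K :=
    isClosed_le q.continuous_aeval.norm p.continuous_aeval.norm
  have hlim := (tendsto_aeval_div_aeval_cobounded hq0 h).norm
  have hev : ∀ᶠ s in cobounded ℂ, s ∉ K := by
    have hinv := tendsto_aeval_div_pow_cobounded (le_refl q.natDegree)
    have hlead : (q.coeff q.natDegree : ℂ) ≠ 0 := by simpa using hq0
    filter_upwards [hlim.eventually_lt_const
      ((norm_leadingCoeff_ratio_le h hq hr).trans_lt hr1),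
      hinv.eventually_ne hlead] with s hs hne
    have hqs : aeval s q ≠ 0 := fun h0 => hne (by simp [h0])
    rw [norm_div, div_lt_one (norm_pos_iff.2 hqs)] at hs
    exact not_le.2 hs
  have hbdd : IsBounded K := by
    rw [isBounded_def]
    exact hev
  have hcomp : IsCompact K := Metric.isCompact_of_isClosed_isBounded hclosed hbdd
  have hneg : ∀ s ∈ K, s.re < 0 := by
    intro s hs
    by_contra! h0
    have := norm_pos_iff.2 (hq s h0)
    have h1 := hr s h0
    have h2 : ‖aeval s q‖ ≤ ‖aeval s p‖ := hs
    nlinarith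
  rcases K.eq_empty_or_nonempty with hempty | hne
  · refine ⟨1, one_pos, fun s _ => ?_⟩
    have : s ∉ K := by simp [hempty]
    exact not_le.1 this
  · obtain ⟨m, hm, hmax⟩ := hcomp.exists_isMaxOn hne Complex.continuous_re.continuousOn
    have := hneg m hm
    refine ⟨-m.re / 2, by linarith, fun s hs => not_le.1 fun hsK => ?_⟩
    have : s.re ≤ m.re := hmax hsK
    linarith

/-! ### Poles, properness and values of fractions not in lowest terms, and of shifts. -/

theorem num_mul_eq_mul_denom {x : RatFunc ℝ} {p q : ℝ[X]} (hq : q ≠ 0)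
    (hx : x = algebraMap ℝ[X] (RatFunc ℝ) p / algebraMap ℝ[X] (RatFunc ℝ) q) :
    x.num * q = p * x.denom := by
  have hq' : algebraMap ℝ[X] (RatFunc ℝ) q ≠ 0 := RatFunc.algebraMap_ne_zero hq
  have hd' : algebraMap ℝ[X] (RatFunc ℝ) x.denom ≠ 0 := RatFunc.algebraMap_ne_zero x.denom_ne_zero
  apply RatFunc.algebraMap_injective ℝ
  rw [map_mul, map_mul, ← div_eq_div_iff hd' hq', RatFunc.num_div_denom, hx]

theorem isPole_imp_aeval_eq_zero {p q : ℝ[X]} {s : ℂ}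
    (h : IsPole (algebraMap ℝ[X] (RatFunc ℝ) p / algebraMap ℝ[X] (RatFunc ℝ) q) s) :
    aeval s q = 0 := by
  obtain ⟨c, hc⟩ := RatFunc.denom_div_dvd p q
  have h' := congrArg (aeval s) hc
  rw [map_mul] at h'
  rw [h', show aeval s _ = 0 from h, zero_mul]

theorem isPole_div_of_isCoprime {p q : ℝ[X]} (hq : q ≠ 0) (hpq : IsCoprime p q) {s : ℂ}
    (h : aeval s q = 0) :
    IsPole (algebraMap ℝ[X] (RatFunc ℝ) p / algebraMap ℝ[X] (RatFunc ℝ) q) s := by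
  have e := num_mul_eq_mul_denom hq (p := p) rfl
  obtain ⟨c, hc⟩ := hpq.symm.dvd_of_dvd_mul_left (Dvd.intro_left _ e)
  rw [IsPole, hc, map_mul, h, zero_mul]

theorem isProper_div_iff {p q : ℝ[X]} (hq : q ≠ 0) :
    IsProper (algebraMap ℝ[X] (RatFunc ℝ) p / algebraMap ℝ[X] (RatFunc ℝ) q) ↔
      p.natDegree ≤ q.natDegree := by
  rcases eq_or_ne p 0 with rfl | hp
  · simp [IsProper]
  have e := num_mul_eq_mul_denom hq (p := p) rfl
  have hd := RatFunc.denom_ne_zero (algebraMap ℝ[X] (RatFunc ℝ) p / algebraMap ℝ[X] (RatFunc ℝ) q)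
  have hn : RatFunc.num (algebraMap ℝ[X] (RatFunc ℝ) p / algebraMap ℝ[X] (RatFunc ℝ) q) ≠ 0 :=
    left_ne_zero_of_mul (e ▸ mul_ne_zero hp hd)
  have := congrArg natDegree e
  rw [natDegree_mul hn hq, natDegree_mul hp hd] at this
  rw [IsProper]
  omega

theorem value_div {p q : ℝ[X]} {s : ℂ} (h : aeval s q ≠ 0) :
    value (algebraMap ℝ[X] (RatFunc ℝ) p / algebraMap ℝ[X] (RatFunc ℝ) q) s =
      aeval s p / aeval s q := by
  have hq : q ≠ 0 := by rintro rfl; simp at h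
  have e := congrArg (aeval s) (num_mul_eq_mul_denom hq (p := p) rfl)
  rw [map_mul, map_mul] at e
  have hd := fun h0 => h (isPole_imp_aeval_eq_zero (p := p) (q := q) (s := s) h0)
  rw [IsPole] at hd
  rw [value, RatFunc.eval, ← aeval_def, ← aeval_def, div_eq_div_iff hd h, e]

theorem value_eq (G : RatFunc ℝ) (s : ℂ) : value G s = aeval s G.num / aeval s G.denom := rfl

theorem aeval_comp_X_sub_C (p : ℝ[X]) (ε : ℝ) (s : ℂ) :
    aeval s (p.comp (X - C ε)) = aeval (s - ε) p := by
  simp [aeval_comp]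

theorem natDegree_comp_X_sub_C (p : ℝ[X]) (ε : ℝ) :
    (p.comp (X - C ε)).natDegree = p.natDegree := by
  simp [natDegree_comp]

theorem comp_X_sub_C_ne_zero {p : ℝ[X]} (hp : p ≠ 0) (ε : ℝ) : p.comp (X - C ε) ≠ 0 := by
  intro h
  have h2 := congrArg (fun r => Polynomial.comp r (X + C ε)) h
  simp [comp_assoc] at h2
  exact hp h2

theorem isProper_shift_iff {ε : ℝ} {H : RatFunc ℝ} : IsProper (shift ε H) ↔ IsProper H := by
  rw [shift, isProper_div_iff (comp_X_sub_C_ne_zero H.denom_ne_zero ε), natDegree_comp_X_sub_C,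
    natDegree_comp_X_sub_C, IsProper]

theorem isPole_shift_iff {ε : ℝ} {H : RatFunc ℝ} {s : ℂ} :
    IsPole (shift ε H) s ↔ IsPole H (s - ε) := by
  refine ⟨fun h => ?_, fun h => ?_⟩
  · have := isPole_imp_aeval_eq_zero h
    rwa [aeval_comp_X_sub_C] at this
  · refine isPole_div_of_isCoprime (comp_X_sub_C_ne_zero H.denom_ne_zero ε) ?_ ?_
    -- Substituting X - ε is a ring homomorphism, so it preserves the Bézout identity.
    · exact H.isCoprime_num_denom.map (compRingHom (X - C ε))
    · rw [aeval_comp_X_sub_C]; exact h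

theorem value_shift {ε : ℝ} {H : RatFunc ℝ} {s : ℂ} (h : ¬ IsPole H (s - ε)) :
    value (shift ε H) s = value H (s - ε) := by
  rw [shift, value_div (by rw [aeval_comp_X_sub_C]; exact h), aeval_comp_X_sub_C,
    aeval_comp_X_sub_C, value_eq]

/-! ### Strict passivity and output feedback. -/

theorem IsStrictlyPassive.isProper {H : RatFunc ℝ} (h : IsStrictlyPassive H) : IsProper H := by
  obtain ⟨ε, -, h⟩ := h
  exact isProper_shift_iff.1 h.proper

theorem IsStrictlyPassive.isStable {H : RatFunc ℝ} (h : IsStrictlyPassive H) : IsStable H := by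
  obtain ⟨ε, hε, h⟩ := h
  intro s hs
  have := h.poles (s + ε) (isPole_shift_iff.2 (by simpa using hs))
  simp at this
  linarith

/-- A proper transfer function without poles and with nonnegative real part on a half-plane
`-ε ≤ Re s`, `ε > 0`, is strictly passive. -/
theorem isStrictlyPassive_of_re_nonneg {H : RatFunc ℝ} (hH : IsProper H) {ε : ℝ} (hε : 0 < ε)
    (hpole : ∀ s : ℂ, -ε ≤ s.re → ¬ IsPole H s) (hre : ∀ s : ℂ, -ε ≤ s.re → 0 ≤ (value H s).re) :
    IsStrictlyPassive H := by
  have hj : ∀ ω : ℝ, -ε ≤ (jAxis ω - ε).re := fun ω => by simp [jAxis]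
  refine ⟨ε, hε, isProper_shift_iff.2 hH, fun s hs => ?_, fun ω _ => ?_, fun ω h => ?_⟩
  · by_contra! h0
    exact hpole _ (by simpa using h0.le) (isPole_shift_iff.1 hs)
  · rw [nyquist, value_shift (hpole _ (hj ω))]
    exact mul_nonneg zero_le_two (hre _ (hj ω))
  · exact absurd (isPole_shift_iff.1 h) (hpole _ (hj ω))

/-- `|1 - 2σG| ≤ 1` means `Re (G / (1 - σG)) ≥ 0`. -/
theorem re_div_sub_mul_nonneg {σ : ℝ} (hσ : 0 < σ) {n d : ℂ}
    (h : ‖d - 2 * σ * n‖ ≤ ‖d‖) : 0 ≤ (n / (d - σ * n)).re := by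
  have h2 : Complex.normSq (d - 2 * σ * n) ≤ Complex.normSq d := by
    rw [Complex.normSq_eq_norm_sq, Complex.normSq_eq_norm_sq]
    gcongr
  rw [Complex.div_re, ← add_div]
  refine div_nonneg ?_ (Complex.normSq_nonneg _)
  simp [Complex.normSq_apply] at h2 ⊢
  -- Expanding `h2` gives 4σ(Re(n d̄) - σ|n|²) ≥ 0, and the bracket is the numerator of the real
  -- part; hence the factor σ.
  refine le_of_mul_le_mul_left ?_ hσ
  nlinarith

theorem sub_mul_ne_zero {σ : ℝ} {n d : ℂ} (h : ‖d - 2 * σ * n‖ < ‖d‖) : d - σ * n ≠ 0 := by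
  intro h0
  have : d - 2 * σ * n = -d := by linear_combination 2 * h0
  simp [this] at h

theorem one_sub_div_mul_C {σ : ℝ} {N D : ℝ[X]} (hD : D ≠ 0) :
    1 - algebraMap ℝ[X] (RatFunc ℝ) N / algebraMap ℝ[X] (RatFunc ℝ) D * RatFunc.C σ =
      algebraMap ℝ[X] (RatFunc ℝ) (D - C σ * N) / algebraMap ℝ[X] (RatFunc ℝ) D := by
  have hD' : algebraMap ℝ[X] (RatFunc ℝ) D ≠ 0 := RatFunc.algebraMap_ne_zero hD
  rw [map_sub, map_mul, RatFunc.algebraMap_C]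
  field_simp

theorem ofSystem_div {σ : ℝ} {N D : ℝ[X]} (hD : D ≠ 0) :
    ofSystem σ (algebraMap ℝ[X] (RatFunc ℝ) N / algebraMap ℝ[X] (RatFunc ℝ) D) =
      algebraMap ℝ[X] (RatFunc ℝ) N / algebraMap ℝ[X] (RatFunc ℝ) (D - C σ * N) := by
  rw [ofSystem, one_sub_div_mul_C hD, inv_div, div_mul_div_comm,
    mul_comm (algebraMap ℝ[X] (RatFunc ℝ) D),
    mul_div_mul_right _ _ (RatFunc.algebraMap_ne_zero hD)]

theorem one_sub_div_mul_C_ne_zero_iff {σ : ℝ} {N D : ℝ[X]} (hD : D ≠ 0) :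
    1 - algebraMap ℝ[X] (RatFunc ℝ) N / algebraMap ℝ[X] (RatFunc ℝ) D * RatFunc.C σ ≠ 0 ↔
      D - C σ * N ≠ 0 := by
  simp only [one_sub_div_mul_C hD, ne_eq, div_eq_zero_iff, hD, or_false,
    map_eq_zero_iff _ (RatFunc.algebraMap_injective ℝ)]

theorem aeval_sub_C_mul (σ : ℝ) (N D : ℝ[X]) (s : ℂ) :
    aeval s (D - C σ * N) = aeval s D - σ * aeval s N := by simp

theorem aeval_sub_C_two_mul (σ : ℝ) (N D : ℝ[X]) (s : ℂ) :
    aeval s (D - C (2 * σ) * N) = aeval s D - 2 * σ * aeval s N := by simp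

theorem natDegree_sub_C_mul_le {N D : ℝ[X]} (h : N.natDegree ≤ D.natDegree) (c : ℝ) :
    (D - C c * N).natDegree ≤ D.natDegree :=
  (natDegree_sub_le _ _).trans (max_le le_rfl ((natDegree_C_mul_le _ _).trans h))

/-- If `|1 - 2σG|` is uniformly smaller than one on the closed right half-plane, then the proper
stable system `G = N / D` is strictly output-feedback passive with index `σ`. -/
theorem isStrictlyOFPassive_div {σ : ℝ} (hσ : 0 < σ) {N D : ℝ[X]}
    (hdeg : N.natDegree ≤ D.natDegree) (hD : ∀ s : ℂ, 0 ≤ s.re → aeval s D ≠ 0)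
    {r : ℝ} (hr1 : r < 1)
    (hr : ∀ s : ℂ, 0 ≤ s.re → ‖aeval s D - 2 * σ * aeval s N‖ ≤ r * ‖aeval s D‖) :
    IsStrictlyOFPassive σ (algebraMap ℝ[X] (RatFunc ℝ) N / algebraMap ℝ[X] (RatFunc ℝ) D) := by
  have hD0 : D ≠ 0 := by rintro rfl; exact hD 0 le_rfl (by simp)
  have hE := natDegree_sub_C_mul_le hdeg (2 * σ)
  have hr' : ∀ s : ℂ, 0 ≤ s.re → ‖aeval s (D - C (2 * σ) * N)‖ ≤ r * ‖aeval s D‖ := by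
    simpa only [aeval_sub_C_two_mul] using hr
  obtain ⟨ε, hε, hlt⟩ := exists_margin hE hD hr1 hr'
  simp only [aeval_sub_C_two_mul] at hlt
  have hne : ∀ s : ℂ, -ε ≤ s.re → aeval s (D - C σ * N) ≠ 0 := fun s hs => by
    rw [aeval_sub_C_mul]
    exact sub_mul_ne_zero (hlt s hs)
  have hQ0 : D - C σ * N ≠ 0 := by
    intro h0
    exact hne 0 (by simpa using hε.le) (by simp [h0])
  -- Properness of the closed loop: if this coefficient vanished, 1 - 2σG would tend to -1 at
  -- infinity, against the bound r < 1.
  have hcoeff : (D - C σ * N).coeff D.natDegree ≠ 0 := by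
    intro h0
    have hle := norm_leadingCoeff_ratio_le hE hD hr'
    have : (D - C (2 * σ) * N).coeff D.natDegree = -D.leadingCoeff := by
      simp only [coeff_sub, coeff_C_mul, coeff_natDegree] at h0 ⊢
      linear_combination 2 * h0
    have hlead : (D.leadingCoeff : ℂ) ≠ 0 := by simpa using hD0
    rw [this, Complex.ofReal_neg, neg_div, div_self hlead] at hle
    simp at hle
    linarith
  refine ⟨(one_sub_div_mul_C_ne_zero_iff hD0).2 hQ0, ?_⟩
  rw [ofSystem_div hD0]
  refine isStrictlyPassive_of_re_nonneg
    ((isProper_div_iff hQ0).2 (hdeg.trans (le_natDegree_of_ne_zero hcoeff))) hε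
    (fun s hs hp => hne s hs (isPole_imp_aeval_eq_zero hp)) fun s hs => ?_
  rw [value_div (hne s hs), aeval_sub_C_mul]
  exact re_div_sub_mul_nonneg hσ (hlt s hs).le

/-- Strict output-feedback passivity with a positive index forces stability, provided that the
Nyquist plot lies in the positive damping region and avoids `1 / σ`. -/
theorem isStable_of_isStrictlyOFPassive {σ : ℝ} (hσ : 0 < σ) {G : RatFunc ℝ}
    (hgeom : GeometricOFConditions σ G)
    (hnorm : ∀ ω : ℝ, ‖aeval (jAxis ω) G.denom - 2 * σ * aeval (jAxis ω) G.num‖ ≤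
      ‖aeval (jAxis ω) G.denom‖)
    (hpass : IsStrictlyOFPassive σ G) : IsStable G := by
  obtain ⟨hne, hH⟩ := hpass
  have hstab := hH.isStable
  have hproper := hH.isProper
  set H := ofSystem σ G with hHdef
  have hb : ∀ s : ℂ, 0 ≤ s.re → aeval s H.denom ≠ 0 := fun s hs h0 => (hstab s h0).not_ge hs
  have hd0 := G.denom_ne_zero
  have hGdiv := G.num_div_denom
  have hH' : H = algebraMap ℝ[X] (RatFunc ℝ) G.num /
      algebraMap ℝ[X] (RatFunc ℝ) (G.denom - C σ * G.num) := by
    rw [← ofSystem_div hd0, hGdiv]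
  have hQ0 : G.denom - C σ * G.num ≠ 0 := by
    rwa [← one_sub_div_mul_C_ne_zero_iff hd0, hGdiv]
  -- Since G(jω) avoids 1/σ, the denominator of H does not vanish on the axis and the disk condition
  -- yields Re H ≥ 0.
  have hjre : ∀ ω : ℝ, 0 ≤ (aeval (jAxis ω) H.num / aeval (jAxis ω) H.denom).re := by
    intro ω
    have hd : aeval (jAxis ω) G.denom ≠ 0 := hgeom.no_imaginary_pole ω
    have hq : aeval (jAxis ω) (G.denom - C σ * G.num) ≠ 0 := by
      rw [aeval_sub_C_mul]
      intro h0
      apply hgeom.avoids ω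
      have hσ' : (σ : ℂ) ≠ 0 := by exact_mod_cast hσ.ne'
      rw [nyquist, value_eq, div_eq_iff hd]
      push_cast
      field_simp
      linear_combination -h0
    rw [← value_eq, hH', value_div hq, aeval_sub_C_mul]
    exact re_div_sub_mul_nonneg hσ (hnorm ω)
  intro s hs
  by_contra! h0
  have hre := re_aeval_div_nonneg_of_jAxis hproper hb hjre h0
  have e := congrArg (aeval s) (num_mul_eq_mul_denom hQ0 hH')
  have hs' : aeval s G.denom = 0 := hs
  have hn : aeval s G.num ≠ 0 := by
    intro hn
    obtain ⟨u, v, huv⟩ := G.isCoprime_num_denom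
    have := congrArg (aeval s) huv
    simp [hn, hs'] at this
  rw [map_mul, map_mul, aeval_sub_C_mul, hs'] at e
  -- At a pole of G the fraction n / (d - σn) has d = 0, while coprimality gives n ≠ 0.
  have hval : aeval s H.num / aeval s H.denom = ((-(1 / σ) : ℝ) : ℂ) := by
    have hσ' : (σ : ℂ) ≠ 0 := by exact_mod_cast hσ.ne'
    rw [div_eq_iff (hb s h0)]
    push_cast
    field_simp
    apply mul_left_cancel₀ hn
    linear_combination -e
  rw [hval, Complex.ofReal_re] at hre
  have : 0 < 1 / σ := by positivity
  linarith

/-! ### Polynomial bounds from d_min and the H∞ norm. -/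

theorem dMin_le {σ : ℝ} {G : RatFunc ℝ} (h : ∀ ω : ℝ, nyquist G ω ∈ pdRegion σ) (ω : ℝ) :
    dMin σ G ≤ 1 / (2 * σ) - ‖nyquist G ω - ((1 / (2 * σ) : ℝ) : ℂ)‖ := by
  -- A real infimum is a lower bound only for a family bounded below; membership in the disk
  -- supplies the bound 0.
  refine ciInf_le ⟨0, ?_⟩ ω
  rintro _ ⟨η, rfl⟩
  have := h η
  rw [pdRegion, mem_closedBall_iff_norm] at this
  exact sub_nonneg.2 this

/-- Since 1 - 2σG = -2σ(G - 1/(2σ)), this is the distance bound scaled by 2σ and cleared of the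
denominator. -/
theorem norm_denom_sub_le {σ : ℝ} (hσ : 0 < σ) {G : RatFunc ℝ} (hgeom : GeometricOFConditions σ G)
    (ω : ℝ) : ‖aeval (jAxis ω) G.denom - 2 * σ * aeval (jAxis ω) G.num‖ ≤
      (1 - 2 * σ * dMin σ G) * ‖aeval (jAxis ω) G.denom‖ := by
  have hd : aeval (jAxis ω) G.denom ≠ 0 := hgeom.no_imaginary_pole ω
  have hσ' : (σ : ℂ) ≠ 0 := by exact_mod_cast hσ.ne'
  have e : aeval (jAxis ω) G.denom - 2 * σ * aeval (jAxis ω) G.num =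
      -((2 * σ : ℝ) : ℂ) * (nyquist G ω - ((1 / (2 * σ) : ℝ) : ℂ)) * aeval (jAxis ω) G.denom := by
    rw [nyquist, value_eq]
    push_cast
    field_simp
    ring
  rw [e, norm_mul, norm_mul, norm_neg, Complex.norm_real, Real.norm_of_nonneg (by positivity)]
  gcongr
  have h1 := mul_le_mul_of_nonneg_left (dMin_le hgeom.mem_region ω)
    (by positivity : 0 ≤ 2 * σ)
  have h2 : 2 * σ * (1 / (2 * σ)) = 1 := by field_simp
  linarith

/-- The supremum sees only Re s > 0. Cleared of denominators, the bound is a closed condition and so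
passes to the imaginary axis. -/
theorem norm_num_le_of_hInfNorm_le {Δ : RatFunc ℝ} (hstable : IsStable Δ) {C : ℝ} (hC : 0 ≤ C)
    (h : hInfNorm Δ ≤ ENNReal.ofReal C) {s : ℂ} (hs : 0 ≤ s.re) :
    ‖aeval s Δ.num‖ ≤ C * ‖aeval s Δ.denom‖ := by
  have hclosed : IsClosed {s : ℂ | ‖aeval s Δ.num‖ ≤ C * ‖aeval s Δ.denom‖} :=
    isClosed_le Δ.num.continuous_aeval.norm (Δ.denom.continuous_aeval.norm.const_mul C)
  have hsub : {z : ℂ | 0 < z.re} ⊆ {s : ℂ | ‖aeval s Δ.num‖ ≤ C * ‖aeval s Δ.denom‖} := by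
    intro z hz
    have hd : aeval z Δ.denom ≠ 0 := fun h0 => (hstable z h0).not_gt hz
    have h1 : ‖value Δ z‖ₑ ≤ ENNReal.ofReal C :=
      (le_iSup₂ (f := fun (s : ℂ) (_ : 0 < s.re) => ‖value Δ s‖ₑ) z hz).trans h
    rw [← ofReal_norm, ENNReal.ofReal_le_ofReal_iff hC, value_eq, norm_div,
      div_le_iff₀ (norm_pos_iff.2 hd)] at h1
    exact h1
  exact closure_minimal hsub hclosed (closure_re_pos ▸ hs)

end LTI

/-! ### Robustness of passivization. -/

theorem theorem4 (σ : ℝ) (hσ : 0 < σ) (G₀ Δ : RatFunc ℝ)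
    (hG₀ : LTI.IsProper G₀) (hgeom : LTI.GeometricOFConditions σ G₀)
    (hpass : LTI.IsStrictlyOFPassive σ G₀)
    (hdist : 0 < LTI.dMin σ G₀)
    (hΔ : LTI.IsProper Δ) (hstable : LTI.IsStable Δ)
    (hnorm : LTI.hInfNorm Δ < ENNReal.ofReal (LTI.dMin σ G₀)) :
    LTI.IsStrictlyOFPassive σ (G₀ + Δ) := by
  have haxis := LTI.norm_denom_sub_le hσ hgeom
  have hstable₀ : LTI.IsStable G₀ := by
    refine LTI.isStable_of_isStrictlyOFPassive hσ hgeom (fun ω => (haxis ω).trans ?_) hpass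
    refine mul_le_of_le_one_left (norm_nonneg _) ?_
    have : 0 < 2 * σ * LTI.dMin σ G₀ := by positivity
    linarith
  have hd₀ : ∀ s : ℂ, 0 ≤ s.re → Polynomial.aeval s G₀.denom ≠ 0 :=
    fun s hs h0 => (hstable₀ s h0).not_ge hs
  have hdΔ : ∀ s : ℂ, 0 ≤ s.re → Polynomial.aeval s Δ.denom ≠ 0 :=
    fun s hs h0 => (hstable s h0).not_ge hs
  -- Stability of G₀ lets the maximum principle carry the axis bound into the half-plane.
  have hF₀ : ∀ s : ℂ, 0 ≤ s.re →
      ‖Polynomial.aeval s G₀.denom - 2 * σ * Polynomial.aeval s G₀.num‖ ≤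
        (1 - 2 * σ * LTI.dMin σ G₀) * ‖Polynomial.aeval s G₀.denom‖ := by
    intro s hs
    rw [← LTI.aeval_sub_C_two_mul]
    refine LTI.norm_aeval_le_of_jAxis (LTI.natDegree_sub_C_mul_le hG₀ _) hd₀ (fun ω => ?_) hs
    rw [LTI.aeval_sub_C_two_mul]
    exact haxis ω
  have htop : LTI.hInfNorm Δ ≠ ⊤ := hnorm.ne_top
  set h := (LTI.hInfNorm Δ).toReal with hh
  have hlt : h < LTI.dMin σ G₀ := (ENNReal.lt_ofReal_iff_toReal_lt htop).1 hnorm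
  have hΔn : ∀ s : ℂ, 0 ≤ s.re →
      ‖Polynomial.aeval s Δ.num‖ ≤ h * ‖Polynomial.aeval s Δ.denom‖ := fun s hs =>
    LTI.norm_num_le_of_hInfNorm_le hstable ENNReal.toReal_nonneg
      (ENNReal.ofReal_toReal htop).ge hs
  have hsum : G₀ + Δ = algebraMap (Polynomial ℝ) (RatFunc ℝ)
        (G₀.num * Δ.denom + G₀.denom * Δ.num) /
      algebraMap (Polynomial ℝ) (RatFunc ℝ) (G₀.denom * Δ.denom) := by
    rw [map_add, map_mul, map_mul, map_mul, ← div_add_div _ _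
      (RatFunc.algebraMap_ne_zero G₀.denom_ne_zero) (RatFunc.algebraMap_ne_zero Δ.denom_ne_zero),
      RatFunc.num_div_denom, RatFunc.num_div_denom]
  rw [hsum]
  -- r is the sum of 1 - 2σ d_min, from G₀, and 2σh, from Δ.
  refine LTI.isStrictlyOFPassive_div hσ ?_ (fun s hs => ?_)
    (r := 1 - 2 * σ * (LTI.dMin σ G₀ - h)) ?_ fun s hs => ?_
  · rw [Polynomial.natDegree_mul G₀.denom_ne_zero Δ.denom_ne_zero]
    refine Polynomial.natDegree_add_le_of_degree_le ?_ ?_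
    · exact Polynomial.natDegree_mul_le.trans (Nat.add_le_add_right hG₀ _)
    · exact Polynomial.natDegree_mul_le.trans (Nat.add_le_add_left hΔ _)
  · rw [map_mul]
    exact mul_ne_zero (hd₀ s hs) (hdΔ s hs)
  · have : 0 < 2 * σ * (LTI.dMin σ G₀ - h) := mul_pos (by positivity) (sub_pos.2 hlt)
    linarith
  · have h1 := mul_le_mul_of_nonneg_right (hF₀ s hs) (norm_nonneg (Polynomial.aeval s Δ.denom))
    have h2 := mul_le_mul_of_nonneg_left (hΔn s hs)
      (by positivity : 0 ≤ 2 * σ * ‖Polynomial.aeval s G₀.denom‖)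
    simp only [map_mul, map_add]
    -- This is 1 - 2σ(G₀ + Δ) = (1 - 2σG₀) - 2σΔ times both denominators.
    have e : Polynomial.aeval s G₀.denom * Polynomial.aeval s Δ.denom -
        2 * (σ : ℂ) * (Polynomial.aeval s G₀.num * Polynomial.aeval s Δ.denom +
          Polynomial.aeval s G₀.denom * Polynomial.aeval s Δ.num) =
        (Polynomial.aeval s G₀.denom - 2 * σ * Polynomial.aeval s G₀.num) *
          Polynomial.aeval s Δ.denom -
        ((2 * σ : ℝ) : ℂ) * Polynomial.aeval s G₀.denom * Polynomial.aeval s Δ.num := by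
      push_cast
      ring
    rw [e, norm_mul]
    refine (norm_sub_le _ _).trans ?_
    rw [norm_mul, norm_mul, norm_mul, Complex.norm_real, Real.norm_of_nonneg (by positivity)]
    linarith
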